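/- Let $\mathbb D=\{|z|<1\}$ and $\mathbb H_1=\{\operatorname{Re} z>0\}$. A one-parameter semigroup in $D\in\{\mathbb D,\mathbb H_1\}$ is a family $(\phi_t)_{t\ge0}$ of holomorphic self-maps of $D$ with $\phi_0=\mathrm{id}_D$, $\phi_{s+t}=\phi_s\circ\phi_t$ for $s,t\ge0$, and $\phi_t(z)\to z$ as $t\to+0$ for each $z\in D$; it is non-trivial if some $\phi_t\ne\mathrm{id}_D$. Its infinitesimal generator is $G(z)=\lim_{t\to+0}(\phi_t(z)-z)/t$, $z\in D$. The Denjoy–Wolff point (DW-point) of a holomorphic $f:\mathbb D\to\mathbb D$, $f\ne\mathrm{id}$, is the point $\tau\in\overline{\mathbb D}$ with $f(\tau)=\tau$ and $|f'(\tau)|\le1$, where for $|\tau|=1$ the value and the derivative are angular limits; the DW-point of a non-trivial semigroup in $\mathbb D$ is the common DW-point of all $\phi_t\neq\mathrm{id}$, $t>0$. A semigroup in $\mathbb H_1$ has DW-point $\infty$ if its conjugate by the Cayley map $\zeta\mapsto(1+\zeta)/(1-\zeta)$ from $\mathbb D$ to $\mathbb H_1$ has DW-point $1$. If the DW-point is $0\in\mathbb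 D$, a Koenigs function is a univalent holomorphic $h:\mathbb D\to\mathbb C$ with $h(0)=0$ and $h\circ\phi_t=\phi_t'(0)\,h$ for all $t\ge0$. For a semigroup $(\tilde\phi_t)$ in $\mathbb H_1$ with DW-point $\infty$, a Koenigs function is a univalent holomorphic $k:\mathbb H_1\to\mathbb C$ with $k\circ\tilde\phi_t=k+t$ for all $t\ge0$. **Proposition 2.1.** Let $(\phi_t)$ be a non-trivial one-parameter semigroup in $\mathbb D$ with DW-point $0$. Then it has an infinitesimal generator $G$ and a Koenigs function $h$, and there exists a unique one-parameter semigroup $(\tilde\phi_t)$ in $\mathbb H_1$ with DW-point $\infty$ such that $$\exp(-\tilde\phi_t(\tilde z))=\phi_t(\exp(-\tilde z))\qquad\text{for all }t\ge0,\ \tilde z\in\mathbb H_1 .$$ Moreover, $G'(0)\ne0$, the infinitesimal generator of $(\tilde\phi_t)$ is $$\tilde G(\tilde z)=-\frac{G(\exp(-\tilde z))}{\exp(-\tilde z)},\qquad \tilde z\in\mathbb H_1,$$ and for every Koenigs function $h$ of $(\phi_t)$ there is a holomorphic $\tilde h:\mathbb H_1\to\mathbb C$ with $\exp(-\tilde h(\tilde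 z))=h(\exp(-\tilde z))$ for all $\tilde z\in\mathbb H_1$. For each such $h$ and $\tilde h$ the function $$\tilde h_0(\tilde z)=-\frac{\tilde h(\tilde z)}{G'(0)},\qquad \tilde z\in\mathbb H_1,$$ is a Koenigs function of $(\tilde\phi_t)$, and every Koenigs function of $(\tilde\phi_t)$ equals $\tilde h_0+c$ on $\mathbb H_1$ for some constant $c\in\mathbb C$. -/

import Mathlib

open Set Filter Topology

namespace SemigroupLift

/-- The open unit disk. -/
def disk : Set ℂ := {z | ‖z‖ < 1}

/-- The right half-plane. -/
def halfPlane : Set ℂ := {z | 0 < z.re}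

/-- `φ t`, `t ≥ 0`, is a one-parameter semigroup of holomorphic self-maps of `D`. Only the values
`φ t z` with `0 ≤ t` and `z ∈ D` matter. -/
structure IsSemigroup (D : Set ℂ) (φ : ℝ → ℂ → ℂ) : Prop where
  mapsTo : ∀ t, 0 ≤ t → MapsTo (φ t) D D
  holomorphic : ∀ t, 0 ≤ t → DifferentiableOn ℂ (φ t) D
  zero : ∀ z ∈ D, φ 0 z = z
  add : ∀ s t, 0 ≤ s → 0 ≤ t → ∀ z ∈ D, φ (s + t) z = φ s (φ t z)
  tendsto_zero : ∀ z ∈ D, Tendsto (fun t => φ t z) (𝓝[>] 0) (𝓝 z)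

/-- At least one of the maps `φ t`, `t ≥ 0`, differs from the identity of `D`. -/
def IsNontrivial (D : Set ℂ) (φ : ℝ → ℂ → ℂ) : Prop :=
  ∃ t, 0 ≤ t ∧ ∃ z ∈ D, φ t z ≠ z

/-- `G` is the infinitesimal generator of the semigroup `φ` in `D`. -/
def IsGenerator (D : Set ℂ) (φ : ℝ → ℂ → ℂ) (G : ℂ → ℂ) : Prop :=
  ∀ z ∈ D, Tendsto (fun t : ℝ => (φ t z - z) / (t : ℂ)) (𝓝[>] 0) (𝓝 (G z))

/-- The Stolz region of aperture `M` at the point `σ` of the unit circle (empty for `M ≤ 1`). -/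
def stolz (σ : ℂ) (M : ℝ) : Set ℂ := {z | ‖z‖ < 1 ∧ ‖z - σ‖ < M * (1 - ‖z‖)}

/-- `f`, defined in the unit disk, has the finite angular limit `l` at `σ`. -/
def HasAngularLimit (f : ℂ → ℂ) (σ l : ℂ) : Prop :=
  ∀ M : ℝ, Tendsto f (𝓝[stolz σ M] σ) (𝓝 l)

/-- `τ` is the Denjoy–Wolff point of a holomorphic self-map `f ≠ id` of the unit disk: a fixed point
(in the disk, or on the circle in the sense of angular limits) at which the (angular) derivative has
modulus at most `1`. -/
def IsMapDWPoint (f : ℂ → ℂ) (τ : ℂ) : Prop :=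
  (‖τ‖ < 1 ∧ f τ = τ ∧ ‖deriv f τ‖ ≤ 1) ∨
  (‖τ‖ = 1 ∧ HasAngularLimit f τ τ ∧
    ∃ d : ℂ, HasAngularLimit (fun z => (f z - τ) / (z - τ)) τ d ∧ ‖d‖ ≤ 1)

/-- `τ` is the Denjoy–Wolff point of the non-trivial semigroup `φ` in the unit disk: the common
Denjoy–Wolff point of all `φ t`, `t > 0`, that differ from the identity. -/
def IsDWPoint (φ : ℝ → ℂ → ℂ) (τ : ℂ) : Prop :=
  IsNontrivial disk φ ∧ ∀ t, 0 < t → (∃ z ∈ disk, φ t z ≠ z) → IsMapDWPoint (φ t) τ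

/-- The Cayley map of the unit disk onto the right half-plane; it sends `1` to `∞`. -/
noncomputable def cayley (ζ : ℂ) : ℂ := (1 + ζ) / (1 - ζ)

/-- The inverse of the Cayley map. -/
noncomputable def cayleyInv (w : ℂ) : ℂ := (w - 1) / (w + 1)

/-- A semigroup in the right half-plane has the Denjoy–Wolff point `∞`: the conjugate semigroup in
the unit disk has the Denjoy–Wolff point `1`. -/
def HasDWPointInfty (ψ : ℝ → ℂ → ℂ) : Prop :=
  IsDWPoint (fun t ζ => cayleyInv (ψ t (cayley ζ))) 1

/-- `h` is a Koenigs function of a semigroup `φ` in the unit disk with the Denjoy–Wolff point `τ`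
inside the disk: a univalent solution of the Schröder equation that vanishes at `τ`. -/
structure IsKoenigsInterior (φ : ℝ → ℂ → ℂ) (τ : ℂ) (h : ℂ → ℂ) : Prop where
  holomorphic : DifferentiableOn ℂ h disk
  univalent : InjOn h disk
  map_point : h τ = 0
  schroeder : ∀ t, 0 ≤ t → ∀ z ∈ disk, h (φ t z) = deriv (φ t) τ * h z

/-- `k` is a Koenigs function of a semigroup `ψ` in the right half-plane with the Denjoy–Wolff point
on the boundary (here: `∞`): a univalent solution of the Abel equation. -/
structure IsKoenigsBoundary (ψ : ℝ → ℂ → ℂ) (k : ℂ → ℂ) : Prop where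
  holomorphic : DifferentiableOn ℂ k halfPlane
  univalent : InjOn k halfPlane
  abel : ∀ t : ℝ, 0 ≤ t → ∀ z ∈ halfPlane, k (ψ t z) = k z + t

/-- `H` is a holomorphic lifting to the right half-plane of `z ↦ h (exp (-z))` with respect to the
covering map `w ↦ exp (-w)` of `ℂ` onto `ℂ \ {0}`. -/
def IsExpLifting (h H : ℂ → ℂ) : Prop :=
  DifferentiableOn ℂ H halfPlane ∧
    ∀ z ∈ halfPlane, Complex.exp (-H z) = h (Complex.exp (-z))

/-- The relation `exp (-ψ t z) = φ t (exp (-z))` for all `t ≥ 0` and all `z` in the right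
half-plane. -/
def Lifts (φ ψ : ℝ → ℂ → ℂ) : Prop :=
  ∀ t, 0 ≤ t → ∀ z ∈ halfPlane, Complex.exp (-ψ t z) = φ t (Complex.exp (-z))

end SemigroupLift

namespace SemigroupLift

/-! Everything is made explicit, so no covering-space argument is needed. All `φ t` fix `0`. Put
`K_ε(z) = ∫₀^ε φ_s(z) ds`. By the semigroup law, `K_ε(φ_t z) - K_ε(z)` is a difference of two
integrals over intervals of length `t`, so its right derivative at `t = 0` is `φ_ε(z) - z`. As
`K_ε'(z) ≠ 0` for small `ε > 0`, the orbit itself has a right derivative `G(z)`, and `φ_ε - id = G ·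
K_ε'` (`sub_eq_generator_mul`). Hence `G` is holomorphic, `G(0) = 0`, and the Schwarz lemma shows
that `g(z) = G(z)/z` has no zeros.

With `λ = G'(0)`, the equation `h' G = λ h` is solved by `h(z) = z exp(P(z))` for a holomorphic `P`;
along orbits it integrates to Schröder's equation `h(φ_t z) = e^{λt} h(z)`. Taking formal logarithms
at `e^{-z}` gives the lift `ψ_t(z) = z - λt - P(e^{-z}) + P(φ_t(e^{-z}))`. The `P` terms die out as
`Re z → ∞`, so `ψ_t` is asymptotically a translation and has DW-point `∞`.

Every Koenigs function in the disk is `c z exp(P(z))`, so its liftings are `z - P(e^{-z})` plus a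
constant, and `ψ_t` lowers them by `-λt` with sign reversed, that is, adds `-λt`. Uniqueness of the
lift follows by small times and iteration, that of the Abel solution from `k' = 1/G̃`. -/

theorem disk_eq_ball : disk = Metric.ball 0 1 := by
  ext z; simp [disk]

theorem isOpen_disk : IsOpen disk := disk_eq_ball ▸ Metric.isOpen_ball

theorem zero_mem_disk : (0 : ℂ) ∈ disk := by simp [disk]

theorem disk_mem_nhds {z : ℂ} (hz : z ∈ disk) : disk ∈ 𝓝 z := isOpen_disk.mem_nhds hz

theorem isPreconnected_disk : IsPreconnected disk :=
  disk_eq_ball ▸ (convex_ball (0 : ℂ) 1).isPreconnected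

theorem isOpen_halfPlane : IsOpen halfPlane := isOpen_lt continuous_const Complex.continuous_re

theorem isPreconnected_halfPlane : IsPreconnected halfPlane :=
  (convex_halfSpace_re_gt 0).isPreconnected

/-! ### Schwarz-type estimates and convergence of derivatives -/

/-- A holomorphic self-map of the disk is Lipschitz at each point, with a constant that depends
only on that point. -/
theorem dist_le_of_mapsTo_disk {f : ℂ → ℂ} (hf : DifferentiableOn ℂ f disk)
    (hm : MapsTo f disk disk) {z w : ℂ} (hz : z ∈ disk) (hw : w ∈ disk) :
    dist (f w) (f z) ≤ 2 / (1 - ‖z‖) * dist w z := by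
  have hz' : ‖z‖ < 1 := hz
  have hpos : 0 < 1 - ‖z‖ := by linarith
  have hbd : ∀ w ∈ disk, dist (f w) (f z) ≤ 2 := fun w hw => by
    have h1 : ‖f w‖ < 1 := hm hw
    have h2 : ‖f z‖ < 1 := hm hz
    rw [dist_eq_norm]
    linarith [norm_sub_le (f w) (f z)]
  have hsub : Metric.ball z (1 - ‖z‖) ⊆ disk := fun y hy => by
    rw [Metric.mem_ball, dist_eq_norm] at hy
    have := norm_add_le (y - z) z
    rw [sub_add_cancel] at this
    change ‖y‖ < 1
    linarith
  by_cases h : w ∈ Metric.ball z (1 - ‖z‖)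
  · exact Complex.dist_le_div_mul_dist_of_mapsTo_ball (hf.mono hsub)
      (fun y hy => hbd y (hsub hy)) h
  -- Far from `z` the trivial bound `2` is enough, because `dist w z ≥ 1 - ‖z‖`.
  · rw [Metric.mem_ball, not_lt] at h
    refine (hbd w hw).trans ?_
    rw [div_mul_eq_mul_div, le_div_iff₀ hpos]
    linarith

/-- Pointwise convergence of holomorphic self-maps of the disk implies the pointwise convergence of
the derivatives. -/
theorem tendsto_deriv_of_tendsto {ι : Type*} {l : Filter ι} [l.IsCountablyGenerated]
    {F : ι → ℂ → ℂ} {f : ℂ → ℂ} (hF : ∀ i, DifferentiableOn ℂ (F i) disk)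
    (hm : ∀ i, MapsTo (F i) disk disk) (hf : DifferentiableOn ℂ f disk)
    (hlim : ∀ z ∈ disk, Tendsto (fun i => F i z) l (𝓝 (f z))) {z : ℂ} (hz : z ∈ disk) :
    Tendsto (fun i => deriv (F i) z) l (𝓝 (deriv f z)) := by
  obtain ⟨r, hr, hrs⟩ := Metric.nhds_basis_closedBall.mem_iff.1 (disk_mem_nhds hz)
  have hI : (2 * Real.pi * Complex.I : ℂ) ≠ 0 := Complex.two_pi_I_ne_zero
  -- Cauchy's formula reduces the claim to dominated convergence on a circle; the bound `r⁻¹` is `r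
  -- · r⁻² · 1`.
  have key : ∀ g : ℂ → ℂ, DifferentiableOn ℂ g disk →
      deriv g z = (2 * Real.pi * Complex.I : ℂ)⁻¹ *
        ∮ w in C(z, r), (1 / (w - z) ^ 2) • g w := fun g hg => by
    rw [(hg.mono hrs).deriv_eq_smul_circleIntegral hr, smul_eq_mul, inv_mul_cancel_left₀ hI]
  rw [key f hf]
  simp_rw [fun i => key (F i) (hF i)]
  refine Tendsto.const_mul _ ?_
  have hmem : ∀ θ : ℝ, circleMap z r θ ∈ disk := fun θ =>
    hrs (Metric.sphere_subset_closedBall (circleMap_mem_sphere z hr.le θ))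
  have hcont : ∀ i, Continuous fun θ : ℝ => F i (circleMap z r θ) := fun i =>
    (hF i).continuousOn.comp_continuous (continuous_circleMap z r) hmem
  unfold circleIntegral
  refine intervalIntegral.tendsto_integral_filter_of_dominated_convergence (fun _ => r⁻¹)
    (Eventually.of_forall fun i => ?_) (Eventually.of_forall fun i => ?_)
    intervalIntegrable_const ?_
  · refine Continuous.aestronglyMeasurable ?_
    simp only [deriv_circleMap, circleMap_sub_center, smul_eq_mul]
    have h0 : ∀ θ : ℝ, circleMap 0 r θ ^ 2 ≠ 0 := fun θ =>
      pow_ne_zero _ (circleMap_ne_center hr.ne')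
    have := continuous_circleMap 0 r
    exact (this.mul continuous_const).mul
      ((continuous_const.div (this.pow 2) h0).mul (hcont i))
  · refine Eventually.of_forall fun θ _ => ?_
    have h1 : ‖F i (circleMap z r θ)‖ ≤ 1 := (show _ < _ from hm i (hmem θ)).le
    simp only [deriv_circleMap, circleMap_sub_center, smul_eq_mul, norm_mul, norm_div, norm_pow,
      norm_circleMap_zero, Complex.norm_I, norm_one, abs_of_pos hr]
    calc r * 1 * (1 / r ^ 2 * ‖F i (circleMap z r θ)‖) ≤ r * 1 * (1 / r ^ 2 * 1) := by gcongr
      _ = r⁻¹ := by field_simp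
  · exact Eventually.of_forall fun θ _ => ((hlim _ (hmem θ)).const_smul _).const_smul _

/-- **Schwarz lemma**, equality case for a slope equal to one. -/
theorem eqOn_id_of_fixed {f : ℂ → ℂ} (hf : DifferentiableOn ℂ f disk) (hm : MapsTo f disk disk)
    (h0 : f 0 = 0) {w : ℂ} (hw : w ∈ disk) (h : dslope f 0 w = 1) : EqOn f id disk := by
  rw [disk_eq_ball] at *
  have := Complex.affine_of_mapsTo_ball_of_norm_dslope_eq_div (R₂ := 1) hf
    (by rw [h0]; exact hm.mono_right Metric.ball_subset_closedBall) hw (by simp [h])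
  intro z hz
  rw [this hz, h0, h]
  simp

/-- **Schwarz lemma**, equality case for the derivative. -/
theorem eqOn_rotation {f : ℂ → ℂ} (hf : DifferentiableOn ℂ f disk) (hm : MapsTo f disk disk)
    (h0 : f 0 = 0) (h : ‖deriv f 0‖ = 1) : EqOn f (fun z => deriv f 0 * z) disk := by
  rw [disk_eq_ball] at *
  have := Complex.affine_of_mapsTo_ball_of_norm_dslope_eq_div (R₂ := 1) hf
    (by rw [h0]; exact hm.mono_right Metric.ball_subset_closedBall)
    (Metric.mem_ball_self one_pos) (by simp [h])
  intro z hz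
  rw [this hz, h0]
  simp [mul_comm]

/-! ### Continuity in time -/

namespace IsSemigroup

variable {φ : ℝ → ℂ → ℂ}

/-- The Lipschitz constant at `z` is the same for all `φ s`, so increments at time `s` are
controlled by those at time `0`. This turns right continuity at `0` into two-sided continuity. -/
theorem dist_le (hφ : IsSemigroup disk φ) {s t : ℝ} (hs : 0 ≤ s) (ht : 0 ≤ t) {z : ℂ}
    (hz : z ∈ disk) : dist (φ t z) (φ s z) ≤ 2 / (1 - ‖z‖) * dist (φ |t - s| z) z := by
  wlog hst : s ≤ t generalizing s t
  · rw [dist_comm, abs_sub_comm]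
    exact this ht hs (le_of_not_ge hst)
  have h0 : 0 ≤ t - s := sub_nonneg.2 hst
  rw [abs_of_nonneg h0]
  have : φ t z = φ s (φ (t - s) z) := by
    rw [← hφ.add s (t - s) hs h0 z hz, add_sub_cancel]
  rw [this]
  exact dist_le_of_mapsTo_disk (hφ.holomorphic s hs) (hφ.mapsTo s hs) hz (hφ.mapsTo _ h0 hz)

theorem continuousOn (hφ : IsSemigroup disk φ) {z : ℂ} (hz : z ∈ disk) :
    ContinuousOn (fun t => φ t z) (Ici 0) := by
  have h0 : ContinuousWithinAt (fun t => φ t z) (Ici 0) 0 := by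
    rw [← continuousWithinAt_Ioi_iff_Ici, ContinuousWithinAt, hφ.zero z hz]
    exact hφ.tendsto_zero z hz
  intro s hs
  have habs : Tendsto (fun t : ℝ => |t - s|) (𝓝[Ici 0] s) (𝓝[Ici 0] 0) := by
    refine tendsto_nhdsWithin_iff.2 ⟨?_, Eventually.of_forall fun t => mem_Ici.2 (abs_nonneg _)⟩
    have : Continuous fun t : ℝ => |t - s| := by fun_prop
    simpa using (this.tendsto s).mono_left nhdsWithin_le_nhds
  have h1 : Tendsto (fun t => φ |t - s| z) (𝓝[Ici 0] s) (𝓝 z) := by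
    have := h0.tendsto.comp habs
    rwa [hφ.zero z hz] at this
  rw [ContinuousWithinAt, tendsto_iff_dist_tendsto_zero]
  have h2 := (tendsto_iff_dist_tendsto_zero.1 h1).const_mul (2 / (1 - ‖z‖))
  rw [mul_zero] at h2
  refine squeeze_zero' (Eventually.of_forall fun _ => dist_nonneg) ?_ h2
  filter_upwards [self_mem_nhdsWithin] with t ht
  exact hφ.dist_le hs ht hz

/-- Clamping the time gives a continuous function on all of `ℝ`, ready for integration. -/
theorem continuous_clamp (hφ : IsSemigroup disk φ) {z : ℂ} (hz : z ∈ disk) :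
    Continuous fun t : ℝ => φ (max t 0) z :=
  (hφ.continuousOn hz).comp_continuous (f := fun t : ℝ => max t 0) (by fun_prop)
    fun _ => mem_Ici.2 (le_max_right _ _)

theorem continuous_deriv_clamp (hφ : IsSemigroup disk φ) {z : ℂ} (hz : z ∈ disk) :
    Continuous fun t : ℝ => deriv (φ (max t 0)) z :=
  continuous_iff_continuousAt.2 fun s =>
    tendsto_deriv_of_tendsto (F := fun t : ℝ => φ (max t 0))
      (fun _ => hφ.holomorphic _ (le_max_right _ _)) (fun _ => hφ.mapsTo _ (le_max_right _ _))
      (hφ.holomorphic _ (le_max_right _ _)) (fun _ hw => (hφ.continuous_clamp hw).tendsto s) hz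

end IsSemigroup
-- The infinitesimal generator
/-- The integral of the trajectory that starts at `z` over the time interval `[0, ε]`. -/
noncomputable def trajectoryIntegral (φ : ℝ → ℂ → ℂ) (ε : ℝ) (z : ℂ) : ℂ :=
  ∫ s in (0 : ℝ)..ε, φ (max s 0) z

/-- The integral of the derivatives of `φ s` at `z` over the time interval `[0, ε]`. -/
noncomputable def derivIntegral (φ : ℝ → ℂ → ℂ) (ε : ℝ) (z : ℂ) : ℂ :=
  ∫ s in (0 : ℝ)..ε, deriv (φ (max s 0)) z

theorem norm_deriv_le_of_mapsTo_disk {f : ℂ → ℂ} (hf : DifferentiableOn ℂ f disk)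
    (hm : MapsTo f disk disk) {z : ℂ} {r : ℝ} (hr : 0 < r) (hz : Metric.ball z r ⊆ disk) :
    ‖deriv f z‖ ≤ 2 / r := by
  refine Complex.norm_deriv_le_div_of_mapsTo_ball (hf.mono hz) (fun y hy => ?_) hr
  have h1 : ‖f y‖ < 1 := hm (hz hy)
  have h2 : ‖f z‖ < 1 := hm (hz (Metric.mem_ball_self hr))
  rw [Metric.mem_closedBall, dist_eq_norm]
  linarith [norm_sub_le (f y) (f z)]

/-- A curve has a right derivative at `0` if its image under a map with nonvanishing derivative
has one. -/
theorem tendsto_slope_of_comp {K : ℂ → ℂ} {K' z d : ℂ} {γ : ℝ → ℂ} (hK : HasDerivAt K K' z)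
    (hK' : K' ≠ 0) (hγ : Tendsto γ (𝓝[>] 0) (𝓝 z))
    (hd : Tendsto (fun t : ℝ => (K (γ t) - K z) / (t : ℂ)) (𝓝[>] 0) (𝓝 d)) :
    Tendsto (fun t : ℝ => (γ t - z) / (t : ℂ)) (𝓝[>] 0) (𝓝 (d / K')) := by
  -- `dslope` rather than a plain quotient, since `γ t = z` may occur for `t > 0`.
  have h1 : Tendsto (fun t => dslope K z (γ t)) (𝓝[>] 0) (𝓝 K') := by
    have := (continuousAt_dslope_same.2 hK.differentiableAt).tendsto.comp hγ
    rwa [dslope_same, hK.deriv] at this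
  refine (hd.div h1 hK').congr' ?_
  filter_upwards [h1.eventually_ne hK'] with t ht
  simp only [Pi.div_apply]
  rw [← sub_smul_dslope K z (γ t), smul_eq_mul]
  field_simp

namespace IsGenerator

variable {D : Set ℂ} {φ : ℝ → ℂ → ℂ} {G : ℂ → ℂ}

theorem eqOn {G' : ℂ → ℂ} (h : IsGenerator D φ G) (h' : IsGenerator D φ G') : EqOn G G' D :=
  fun z hz => tendsto_nhds_unique (h z hz) (h' z hz)

/-- The law `φ_s z = φ_{s-t}(φ_t z)` carries the right derivative at `0` to time `t`. Right
derivatives suffice for the differential equations below. -/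
theorem hasDerivWithinAt (h : IsGenerator D φ G) (hφ : IsSemigroup D φ) {z : ℂ} (hz : z ∈ D)
    {t : ℝ} (ht : 0 ≤ t) : HasDerivWithinAt (fun s => φ s z) (G (φ t z)) (Ici t) t := by
  rw [← hasDerivWithinAt_Ioi_iff_Ici, hasDerivWithinAt_iff_tendsto_slope' (by simp)]
  have h1 := h _ (hφ.mapsTo t ht hz)
  have h2 : Tendsto (fun s : ℝ => s - t) (𝓝[>] t) (𝓝[>] 0) := by
    refine tendsto_nhdsWithin_iff.2 ⟨?_, ?_⟩
    · have : Continuous fun s : ℝ => s - t := by fun_prop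
      simpa using (this.tendsto t).mono_left nhdsWithin_le_nhds
    · filter_upwards [self_mem_nhdsWithin] with s hs
      exact sub_pos.2 (mem_Ioi.1 hs)
  refine (h1.comp h2).congr' ?_
  filter_upwards [self_mem_nhdsWithin] with s hs
  have hs' : 0 ≤ s - t := (sub_pos.2 (mem_Ioi.1 hs)).le
  simp only [Function.comp_apply]
  rw [← hφ.add _ _ hs' ht z hz, sub_add_cancel, slope_def_module, Complex.real_smul,
    Complex.ofReal_inv, div_eq_inv_mul]

end IsGenerator

namespace IsSemigroup

variable {φ : ℝ → ℂ → ℂ}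

theorem hasDerivAt_trajectoryIntegral (hφ : IsSemigroup disk φ) (ε : ℝ) {z : ℂ} (hz : z ∈ disk) :
    HasDerivAt (trajectoryIntegral φ ε) (derivIntegral φ ε z) z := by
  obtain ⟨r, hr, hrs⟩ := Metric.nhds_basis_ball.mem_iff.1 (disk_mem_nhds hz)
  have hr2 : 0 < r / 2 := half_pos hr
  have hball : ∀ x ∈ Metric.ball z (r / 2), Metric.ball x (r / 2) ⊆ disk := fun x hx y hy => by
    refine hrs ?_
    rw [Metric.mem_ball] at *
    linarith [dist_triangle y x z]
  have hmem : ∀ x ∈ Metric.ball z (r / 2), x ∈ disk := fun x hx =>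
    hball x hx (Metric.mem_ball_self hr2)
  refine (intervalIntegral.hasDerivAt_integral_of_dominated_loc_of_deriv_le
    (F := fun x s => φ (max s 0) x) (F' := fun x s => deriv (φ (max s 0)) x)
    (s := Metric.ball z (r / 2)) (bound := fun _ => 2 / (r / 2))
    (Metric.ball_mem_nhds z hr2) ?_ ?_ ?_ ?_ intervalIntegrable_const ?_).2
  · filter_upwards [Metric.ball_mem_nhds z hr2] with x hx
    exact (hφ.continuous_clamp (hmem x hx)).aestronglyMeasurable
  · exact (hφ.continuous_clamp hz).intervalIntegrable _ _
  · exact (hφ.continuous_deriv_clamp hz).aestronglyMeasurable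
  · exact Eventually.of_forall fun s _ x hx => norm_deriv_le_of_mapsTo_disk
      (hφ.holomorphic _ (le_max_right _ _)) (hφ.mapsTo _ (le_max_right _ _)) hr2 (hball x hx)
  · exact Eventually.of_forall fun s _ x hx =>
      ((hφ.holomorphic _ (le_max_right _ _)).differentiableAt
        (disk_mem_nhds (hmem x hx))).hasDerivAt

theorem differentiableOn_derivIntegral (hφ : IsSemigroup disk φ) (ε : ℝ) :
    DifferentiableOn ℂ (derivIntegral φ ε) disk := by
  have h : DifferentiableOn ℂ (trajectoryIntegral φ ε) disk := fun z hz =>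
    (hφ.hasDerivAt_trajectoryIntegral ε hz).differentiableAt.differentiableWithinAt
  exact (h.deriv isOpen_disk).congr fun z hz => (hφ.hasDerivAt_trajectoryIntegral ε hz).deriv.symm

theorem deriv_zero_time (hφ : IsSemigroup disk φ) {z : ℂ} (hz : z ∈ disk) :
    deriv (φ 0) z = 1 := by
  have : φ 0 =ᶠ[𝓝 z] id := by
    filter_upwards [disk_mem_nhds hz] with w hw
    exact hφ.zero w hw
  rw [this.deriv_eq, deriv_id]

/-- As a function of `ε` the integral vanishes at `0` and has derivative `(φ 0)'(z) = 1` there. -/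
theorem eventually_derivIntegral_ne_zero (hφ : IsSemigroup disk φ) {z : ℂ} (hz : z ∈ disk) :
    ∀ᶠ ε in 𝓝[>] (0 : ℝ), derivIntegral φ ε z ≠ 0 := by
  have hc := hφ.continuous_deriv_clamp hz
  have h := hc.integral_hasStrictDerivAt 0 0
  have h1 : deriv (φ (max 0 0)) z ≠ 0 := by
    rw [max_self, hφ.deriv_zero_time hz]
    exact one_ne_zero
  exact (h.hasDerivAt.eventually_ne h1).filter_mono
    (nhdsWithin_mono _ fun x (hx : 0 < x) => hx.ne')

theorem tendsto_slope_trajectoryIntegral (hφ : IsSemigroup disk φ) {ε : ℝ} (hε : 0 ≤ ε) {z : ℂ}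
    (hz : z ∈ disk) :
    Tendsto (fun t : ℝ => (trajectoryIntegral φ ε (φ t z) - trajectoryIntegral φ ε z) / (t : ℂ))
      (𝓝[>] 0) (𝓝 (φ ε z - z)) := by
  have hc := hφ.continuous_clamp hz
  have hint : ∀ a b, IntervalIntegrable (fun s : ℝ => φ (max s 0) z) MeasureTheory.volume a b :=
    fun a b => hc.intervalIntegrable a b
  set A : ℝ → ℂ := fun x => ∫ s in (0 : ℝ)..x, φ (max s 0) z with hA
  have hA' : ∀ x, HasDerivAt A (φ (max x 0) z) x := fun x =>
    (hc.integral_hasStrictDerivAt 0 x).hasDerivAt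
  -- Integrating the orbit of `φ t z` over `[0, ε]` is integrating that of `z` over `[t, t + ε]`.
  have hB : HasDerivAt (fun t => A (t + ε) - A t) (φ ε z - z) 0 := by
    have h1 : HasDerivAt (fun t => A (t + ε)) (φ ε z) 0 := by
      have := hA' (0 + ε)
      rw [zero_add, max_eq_left hε] at this
      exact HasDerivAt.comp_add_const 0 ε (by rwa [zero_add])
    have h2 := hA' 0
    rw [max_self, hφ.zero z hz] at h2
    exact h1.sub h2
  have hs := hasDerivAt_iff_tendsto_slope.1 hB
  refine (hs.mono_left (nhdsWithin_mono _ fun x (hx : 0 < x) => hx.ne')).congr' ?_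
  filter_upwards [self_mem_nhdsWithin] with t ht
  have ht' : 0 ≤ t := (show 0 < t from ht).le
  have key : trajectoryIntegral φ ε (φ t z) = A (t + ε) - A t := by
    have h1 : trajectoryIntegral φ ε (φ t z) = ∫ s in (0 : ℝ)..ε, φ (max (s + t) 0) z := by
      refine intervalIntegral.integral_congr fun s hs => ?_
      rw [uIcc_of_le hε] at hs
      rw [max_eq_left hs.1, max_eq_left (add_nonneg hs.1 ht'), hφ.add s t hs.1 ht' z hz]
    rw [h1, intervalIntegral.integral_comp_add_right (fun s => φ (max s 0) z) t, zero_add,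
      hA, add_comm ε t, intervalIntegral.integral_interval_sub_left (hint _ _) (hint _ _)]
  rw [key, slope_def_module, Complex.real_smul, sub_zero, Complex.ofReal_inv, ← div_eq_inv_mul]
  congr 1
  simp [hA, trajectoryIntegral]

/-- A semigroup of holomorphic self-maps of the disk has an infinitesimal generator. -/
theorem exists_isGenerator (hφ : IsSemigroup disk φ) : ∃ G, IsGenerator disk φ G := by
  have : ∀ z ∈ disk, ∃ l,
      Tendsto (fun t : ℝ => (φ t z - z) / (t : ℂ)) (𝓝[>] 0) (𝓝 l) := fun z hz => by
    obtain ⟨ε, hne, hε⟩ := ((hφ.eventually_derivIntegral_ne_zero hz).and self_mem_nhdsWithin).exists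
    exact ⟨_, tendsto_slope_of_comp (hφ.hasDerivAt_trajectoryIntegral ε hz) hne
      (hφ.tendsto_zero z hz) (hφ.tendsto_slope_trajectoryIntegral (le_of_lt hε) hz)⟩
  choose! G hG using this
  exact ⟨G, hG⟩

/-- Both sides are the right derivative at `t = 0` of the trajectory integral along the orbit, the
right one by the chain rule. -/
theorem sub_eq_generator_mul (hφ : IsSemigroup disk φ) {G : ℂ → ℂ} (hG : IsGenerator disk φ G)
    {ε : ℝ} (hε : 0 ≤ ε) {z : ℂ} (hz : z ∈ disk) : φ ε z - z = G z * derivIntegral φ ε z := by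
  refine tendsto_nhds_unique (hφ.tendsto_slope_trajectoryIntegral hε hz) ?_
  have hK := hφ.hasDerivAt_trajectoryIntegral ε hz
  have h1 : Tendsto (fun t => dslope (trajectoryIntegral φ ε) z (φ t z)) (𝓝[>] 0)
      (𝓝 (derivIntegral φ ε z)) := by
    have := (continuousAt_dslope_same.2 hK.differentiableAt).tendsto.comp (hφ.tendsto_zero z hz)
    rwa [dslope_same, hK.deriv] at this
  refine ((hG z hz).mul h1).congr fun t => ?_
  rw [← sub_smul_dslope (trajectoryIntegral φ ε) z (φ t z), smul_eq_mul, div_mul_eq_mul_div]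

theorem differentiableOn_generator (hφ : IsSemigroup disk φ) {G : ℂ → ℂ}
    (hG : IsGenerator disk φ G) : DifferentiableOn ℂ G disk := fun z hz => by
  obtain ⟨ε, hne, hε⟩ := ((hφ.eventually_derivIntegral_ne_zero hz).and self_mem_nhdsWithin).exists
  have hε' : 0 ≤ ε := le_of_lt hε
  have hd := (hφ.differentiableOn_derivIntegral ε).differentiableAt (disk_mem_nhds hz)
  have hf := (hφ.holomorphic ε hε').differentiableAt (disk_mem_nhds hz)
  refine DifferentiableAt.differentiableWithinAt ?_
  refine ((hf.sub differentiableAt_id).div hd hne).congr_of_eventuallyEq ?_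
  filter_upwards [disk_mem_nhds hz, hd.continuousAt.eventually_ne hne] with w hw hwne
  simp only [Pi.div_apply, Pi.sub_apply, id]
  rw [hφ.sub_eq_generator_mul hG hε' hw, mul_div_cancel_right₀ _ hwne]

theorem generator_zero (hφ : IsSemigroup disk φ) (h0 : ∀ t, 0 ≤ t → φ t 0 = 0) {G : ℂ → ℂ}
    (hG : IsGenerator disk φ G) : G 0 = 0 := by
  obtain ⟨ε, hne, hε⟩ := ((hφ.eventually_derivIntegral_ne_zero zero_mem_disk).and
    self_mem_nhdsWithin).exists
  have := hφ.sub_eq_generator_mul hG (le_of_lt hε) zero_mem_disk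
  rw [h0 ε (le_of_lt hε), sub_zero, eq_comm, mul_eq_zero] at this
  exact this.resolve_right hne

theorem deriv_sub_one_eq (hφ : IsSemigroup disk φ) (h0 : ∀ t, 0 ≤ t → φ t 0 = 0) {G : ℂ → ℂ}
    (hG : IsGenerator disk φ G)
    {ε : ℝ} (hε : 0 ≤ ε) :
    deriv (φ ε) 0 - 1 = deriv G 0 * derivIntegral φ ε 0 := by
  have hn := disk_mem_nhds zero_mem_disk
  have h1 := ((hφ.holomorphic ε hε).differentiableAt hn).hasDerivAt.sub (hasDerivAt_id (0 : ℂ))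
  have h2 := ((hφ.differentiableOn_generator hG).differentiableAt hn).hasDerivAt.mul
    ((hφ.differentiableOn_derivIntegral ε).differentiableAt hn).hasDerivAt
  rw [hφ.generator_zero h0 hG, zero_mul, add_zero] at h2
  refine (h1.congr_of_eventuallyEq ?_).unique h2
  filter_upwards [hn] with w hw
  simp only [Pi.mul_apply, Pi.sub_apply, id]
  exact (hφ.sub_eq_generator_mul hG hε hw).symm

/-- At a zero `w` every `φ t` would have slope `1` between `0` and `w` (derivative `1` if `w = 0`),
hence be the identity by the Schwarz lemma. -/
theorem dslope_generator_ne_zero (hφ : IsSemigroup disk φ) (h0 : ∀ t, 0 ≤ t → φ t 0 = 0) {G : ℂ → ℂ}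
    (hG : IsGenerator disk φ G)
    (hnt : IsNontrivial disk φ) {w : ℂ} (hw : w ∈ disk) :
    dslope G 0 w ≠ 0 := by
  intro hzero
  obtain ⟨t, ht, z, hz, hne⟩ := hnt
  refine hne (eqOn_id_of_fixed (hφ.holomorphic t ht) (hφ.mapsTo t ht) (h0 t ht) hw ?_ hz)
  rcases eq_or_ne w 0 with rfl | hw0
  · rw [dslope_same] at hzero ⊢
    have := hφ.deriv_sub_one_eq h0 hG ht
    rwa [hzero, zero_mul, sub_eq_zero] at this
  · have hGw : G w = 0 := by
      have := sub_smul_dslope G 0 w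
      rwa [hzero, smul_zero, hφ.generator_zero h0 hG, sub_zero, eq_comm] at this
    have := hφ.sub_eq_generator_mul hG ht hw
    rw [hGw, zero_mul, sub_eq_zero] at this
    rw [dslope_of_ne _ hw0, slope_def_field, this, h0 t ht]
    simp [hw0]

theorem deriv_generator_ne_zero (hφ : IsSemigroup disk φ) (h0 : ∀ t, 0 ≤ t → φ t 0 = 0) {G : ℂ → ℂ}
    (hG : IsGenerator disk φ G)
    (hnt : IsNontrivial disk φ) : deriv G 0 ≠ 0 := by
  have := hφ.dslope_generator_ne_zero h0 hG hnt zero_mem_disk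
  rwa [dslope_same] at this

end IsSemigroup
-- The Koenigs function in the disk
/-- `P` is the holomorphic function in the disk, vanishing at `0`, for which `z ↦ z * exp (P z)`
solves the equation `h' * G = G' 0 * h`. -/
structure IsKoenigsLog (G P : ℂ → ℂ) : Prop where
  map_zero : P 0 = 0
  holomorphic : DifferentiableOn ℂ P disk
  deriv_eq : ∀ z ∈ disk, dslope G 0 z * (1 + z * deriv P z) = deriv G 0

/-- With `g = dslope G 0`, the equation reads `P' = -((g - g 0) / z) / g`; the singularity at `0` is
removable, and a primitive exists in the disk. -/
theorem exists_isKoenigsLog {G : ℂ → ℂ} (hG : DifferentiableOn ℂ G disk)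
    (hne : ∀ z ∈ disk, dslope G 0 z ≠ 0) : ∃ P, IsKoenigsLog G P := by
  have hn := disk_mem_nhds zero_mem_disk
  have h1 : DifferentiableOn ℂ (dslope G 0) disk := (Complex.differentiableOn_dslope hn).2 hG
  have h2 : DifferentiableOn ℂ (dslope (dslope G 0) 0) disk :=
    (Complex.differentiableOn_dslope hn).2 h1
  have h3 : DifferentiableOn ℂ (fun z => -(dslope (dslope G 0) 0 z / dslope G 0 z)) disk :=
    (h2.div h1 hne).neg
  rw [disk_eq_ball] at h3
  obtain ⟨P, hP0, hP⟩ := h3.isExactOn_ball.with_val_at 0 0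
  rw [← disk_eq_ball] at hP
  refine ⟨P, hP0, fun z hz => (hP z hz).differentiableAt.differentiableWithinAt, fun z hz => ?_⟩
  rw [(hP z hz).deriv]
  have h4 := sub_smul_dslope (dslope G 0) 0 z
  rw [sub_zero, smul_eq_mul, dslope_same] at h4
  have := hne z hz
  field_simp
  linear_combination -h4

theorem IsKoenigsLog.hasDerivAt {G P : ℂ → ℂ} (hP : IsKoenigsLog G P) {z : ℂ} (hz : z ∈ disk) :
    HasDerivAt (fun z => z * Complex.exp (P z)) (Complex.exp (P z) * (1 + z * deriv P z)) z := by
  have h := (hP.holomorphic.differentiableAt (disk_mem_nhds hz)).hasDerivAt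
  refine HasDerivAt.congr_deriv (f' := 1 * Complex.exp (P z) + z * (Complex.exp (P z) * deriv P z))
    ((hasDerivAt_id z).mul h.cexp) ?_
  ring

theorem generator_eq_mul_dslope {G : ℂ → ℂ} (h : G 0 = 0) (z : ℂ) : z * dslope G 0 z = G z := by
  have := sub_smul_dslope G 0 z
  rwa [sub_zero, smul_eq_mul, h, sub_zero] at this

/-- A function with nonvanishing strict derivative is injective along curves that tend to the
same point. -/
theorem eventuallyEq_of_hasStrictDerivAt {f : ℂ → ℂ} {f' p : ℂ} (hf : HasStrictDerivAt f f' p)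
    (hf' : f' ≠ 0) {ι : Type*} {l : Filter ι} {γ δ : ι → ℂ} (hγ : Tendsto γ l (𝓝 p))
    (hδ : Tendsto δ l (𝓝 p)) (h : ∀ᶠ i in l, f (γ i) = f (δ i)) : ∀ᶠ i in l, γ i = δ i := by
  have := HasStrictDerivAt.eventually_left_inverse hf hf'
  filter_upwards [hγ.eventually this, hδ.eventually this, h] with i h1 h2 h3
  rw [← h1, h3, h2]

namespace IsSemigroup

variable {φ : ℝ → ℂ → ℂ}

theorem norm_le (hφ : IsSemigroup disk φ) (h0 : ∀ t, 0 ≤ t → φ t 0 = 0) {t : ℝ} (ht : 0 ≤ t)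
    {z : ℂ} (hz : z ∈ disk) : ‖φ t z‖ ≤ ‖z‖ := by
  have h1 := hφ.holomorphic t ht
  have h2 := hφ.mapsTo t ht
  rw [disk_eq_ball] at h1 h2
  exact Complex.norm_le_norm_of_mapsTo_ball h1 (h2.mono_right Metric.ball_subset_closedBall)
    (h0 t ht) hz

/-- The Schröder equation for `z ↦ z * exp (P z)`. -/
theorem koenigsLog_schroeder (hφ : IsSemigroup disk φ) (h0 : ∀ t, 0 ≤ t → φ t 0 = 0)
    {G P : ℂ → ℂ} (hG : IsGenerator disk φ G) (hP : IsKoenigsLog G P) {T : ℝ} (hT : 0 ≤ T)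
    {z : ℂ} (hz : z ∈ disk) :
    φ T z * Complex.exp (P (φ T z)) =
      Complex.exp (deriv G 0 * T) * (z * Complex.exp (P z)) := by
  set h : ℂ → ℂ := fun z => z * Complex.exp (P z) with hh
  -- `u` is constant: its right derivative vanishes because `h' G = G'(0) h`.
  set u : ℝ → ℂ := fun t => Complex.exp (-(deriv G 0 * t)) * h (φ t z) with hu
  have hder : ∀ t ∈ Ico 0 T, HasDerivWithinAt u 0 (Ici t) t := fun t ht => by
    have hm := hφ.mapsTo t ht.1 hz
    have h1 := (hP.hasDerivAt hm).comp_hasDerivWithinAt t (hG.hasDerivWithinAt hφ hz ht.1)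
    have h2 : HasDerivAt (fun t : ℝ => Complex.exp (-(deriv G 0 * t)))
        (Complex.exp (-(deriv G 0 * t)) * -(deriv G 0)) t := by
      have := (((hasDerivAt_id t).ofReal_comp).const_mul (deriv G 0)).neg.cexp
      simpa using this
    have h3 := hP.deriv_eq _ hm
    have h4 := generator_eq_mul_dslope (hφ.generator_zero h0 hG) (φ t z)
    refine HasDerivWithinAt.congr_deriv (h2.hasDerivWithinAt.mul h1) ?_
    change Complex.exp (-(deriv G 0 * t)) * -deriv G 0 * (φ t z * Complex.exp (P (φ t z))) +
      Complex.exp (-(deriv G 0 * t)) * (Complex.exp (P (φ t z)) *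
        (1 + φ t z * deriv P (φ t z)) * G (φ t z)) = 0
    rw [← h4]
    linear_combination (Complex.exp (-(deriv G 0 * t)) * φ t z *
      Complex.exp (P (φ t z))) * h3
  have hcont : ContinuousOn u (Icc 0 T) := by
    have hhc : ContinuousOn h disk := fun y hy =>
      (hP.hasDerivAt hy).continuousAt.continuousWithinAt
    refine ContinuousOn.mul (by fun_prop) ?_
    exact hhc.comp ((hφ.continuousOn hz).mono Icc_subset_Ici_self)
      fun t ht => hφ.mapsTo t ht.1 hz
  have := constant_of_has_deriv_right_zero hcont hder T ⟨hT, le_rfl⟩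
  simp only [hu, hφ.zero z hz] at this
  change h (φ T z) = _ * h z
  have h5 : h (φ T z) = Complex.exp (deriv G 0 * T) *
      (Complex.exp (-(deriv G 0 * T)) * h (φ T z)) := by
    rw [← mul_assoc, ← Complex.exp_add]; simp
  rw [h5, this]
  simp

theorem deriv_eq_exp (hφ : IsSemigroup disk φ) (h0 : ∀ t, 0 ≤ t → φ t 0 = 0)
    {G P : ℂ → ℂ} (hG : IsGenerator disk φ G) (hP : IsKoenigsLog G P) {t : ℝ} (ht : 0 ≤ t) :
    deriv (φ t) 0 = Complex.exp (deriv G 0 * t) := by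
  have hn := disk_mem_nhds zero_mem_disk
  have hh := hP.hasDerivAt zero_mem_disk
  have hφ' := ((hφ.holomorphic t ht).differentiableAt hn).hasDerivAt
  have h1 := HasDerivAt.comp (h₂ := fun z => z * Complex.exp (P z)) 0
    (by rw [h0 t ht]; exact hh) hφ'
  have h2 := hh.const_mul (Complex.exp (deriv G 0 * t))
  have h3 := (h2.congr_of_eventuallyEq (f₁ := (fun z => z * Complex.exp (P z)) ∘ φ t) (by
    filter_upwards [hn] with w hw
    exact hφ.koenigsLog_schroeder h0 hG hP ht hw)).unique h1
  simpa [hP.map_zero] using h3.symm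

/-- The orbit stays in the closed ball of radius `‖z‖`, where `P` is bounded, so Schröder's equation
forces exponential decay. -/
theorem tendsto_atTop (hφ : IsSemigroup disk φ) (h0 : ∀ t, 0 ≤ t → φ t 0 = 0)
    {G P : ℂ → ℂ} (hG : IsGenerator disk φ G) (hP : IsKoenigsLog G P)
    (hre : (deriv G 0).re < 0) {z : ℂ} (hz : z ∈ disk) :
    Tendsto (fun t => φ t z) atTop (𝓝 0) := by
  have hsub : Metric.closedBall (0 : ℂ) ‖z‖ ⊆ disk := fun y hy =>
    (mem_closedBall_zero_iff.1 hy).trans_lt hz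
  obtain ⟨M, hM⟩ := (isCompact_closedBall (0 : ℂ) ‖z‖).exists_bound_of_continuousOn
    (hP.holomorphic.continuousOn.mono hsub)
  have hlim : Tendsto (fun t : ℝ => Real.exp ((deriv G 0).re * t) *
      (‖z * Complex.exp (P z)‖ * Real.exp M)) atTop (𝓝 0) := by
    have := (Real.tendsto_exp_atBot.comp
      (tendsto_id.const_mul_atTop_of_neg hre)).mul_const (‖z * Complex.exp (P z)‖ * Real.exp M)
    simpa using this
  refine squeeze_zero_norm' ?_ hlim
  filter_upwards [eventually_ge_atTop 0] with t ht
  have h1 := congrArg norm (hφ.koenigsLog_schroeder h0 hG hP ht hz)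
  rw [norm_mul, norm_mul (Complex.exp _), Complex.norm_exp, Complex.norm_exp] at h1
  have h2 : -M ≤ (P (φ t z)).re := by
    have h3 := hM (φ t z) (mem_closedBall_zero_iff.2 (hφ.norm_le h0 ht hz))
    have h4 := (abs_le.1 (Complex.abs_re_le_norm (P (φ t z)))).1
    linarith
  have h3 : (deriv G 0 * t).re = (deriv G 0).re * t := by simp
  rw [h3] at h1
  calc ‖φ t z‖ = ‖φ t z‖ * (Real.exp (-M) * Real.exp M) := by rw [← Real.exp_add]; simp
    _ ≤ ‖φ t z‖ * (Real.exp (P (φ t z)).re * Real.exp M) := by gcongr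
    _ = _ := by rw [← mul_assoc, h1, mul_assoc]

/-- Two orbits with equal values of `h = z exp(P z)` keep them equal and tend to `0`, where `h` is
locally injective, so they eventually meet. If the first meeting time were positive, local
injectivity at the meeting point would make them agree slightly earlier. -/
theorem eq_of_koenigsLog_eq (hφ : IsSemigroup disk φ) (h0 : ∀ t, 0 ≤ t → φ t 0 = 0)
    {G P : ℂ → ℂ} (hG : IsGenerator disk φ G) (hP : IsKoenigsLog G P)
    (hre : (deriv G 0).re < 0) {z w : ℂ} (hz : z ∈ disk) (hw : w ∈ disk)
    (h : z * Complex.exp (P z) = w * Complex.exp (P w)) : z = w := by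
  have hlam : deriv G 0 ≠ 0 := fun h => by simp [h] at hre
  have hstrict : ∀ p ∈ disk, ∃ d ≠ 0,
      HasStrictDerivAt (fun z => z * Complex.exp (P z)) d p := fun p hp => by
    have hd : DifferentiableOn ℂ (fun z => z * Complex.exp (P z)) disk := fun y hy =>
      (hP.hasDerivAt hy).differentiableAt.differentiableWithinAt
    have hs := ((hd.contDiffOn isOpen_disk (n := 1)).contDiffAt
      (disk_mem_nhds hp)).hasStrictDerivAt one_ne_zero
    refine ⟨_, ?_, hs⟩
    rw [(hP.hasDerivAt hp).deriv]
    exact mul_ne_zero (Complex.exp_ne_zero _)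
      (right_ne_zero_of_mul ((hP.deriv_eq p hp).trans_ne hlam))
  have hflow : ∀ t, 0 ≤ t →
      φ t z * Complex.exp (P (φ t z)) = φ t w * Complex.exp (P (φ t w)) := fun t ht => by
    rw [hφ.koenigsLog_schroeder h0 hG hP ht hz, hφ.koenigsLog_schroeder h0 hG hP ht hw, h]
  set S : Set ℝ := {t | φ (max t 0) z = φ (max t 0) w} ∩ Ici 0 with hS
  have hclosed : IsClosed S :=
    (isClosed_eq (hφ.continuous_clamp hz) (hφ.continuous_clamp hw)).inter isClosed_Ici
  have hne : S.Nonempty := by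
    obtain ⟨d, hd, hs⟩ := hstrict 0 zero_mem_disk
    have hev : ∀ᶠ t : ℝ in atTop, 0 ≤ t := eventually_ge_atTop 0
    obtain ⟨t, ht, ht0⟩ := ((eventuallyEq_of_hasStrictDerivAt hs hd
      (hφ.tendsto_atTop h0 hG hP hre hz) (hφ.tendsto_atTop h0 hG hP hre hw)
      (hev.mono hflow)).and hev).exists
    refine ⟨t, ?_, ht0⟩
    rwa [mem_ofPred_eq, max_eq_left ht0]
  have hbdd : BddBelow S := ⟨0, fun t ht => ht.2⟩
  have hmem : sInf S ∈ S := hclosed.csInf_mem hne hbdd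
  rcases (mem_Ici.1 hmem.2).eq_or_lt with hT | hT
  · have := hmem.1
    rw [mem_ofPred_eq, ← hT, max_self, hφ.zero z hz, hφ.zero w hw] at this
    exact this
  · exfalso
    obtain ⟨d, hd, hs⟩ := hstrict _ (hφ.mapsTo (max (sInf S) 0) (le_max_right _ _) hz)
    have h1 := ((hφ.continuous_clamp hz).tendsto (sInf S)).mono_left
      (nhdsWithin_le_nhds (s := Iio (sInf S)))
    have h2 := ((hφ.continuous_clamp hw).tendsto (sInf S)).mono_left
      (nhdsWithin_le_nhds (s := Iio (sInf S)))
    rw [← (show _ = _ from hmem.1)] at h2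
    have h3 := eventuallyEq_of_hasStrictDerivAt hs hd h1 h2
      (Eventually.of_forall fun t => hflow _ (le_max_right _ _))
    obtain ⟨t, ht, ht'⟩ := (h3.and (Ioo_mem_nhdsLT hT)).exists
    exact absurd (csInf_le hbdd (⟨ht, ht'.1.le⟩ : t ∈ S)) (not_le.2 ht'.2)

/-- A semigroup that fixes the origin has a Koenigs function if its generator admits a Koenigs logarithm. -/
theorem exists_isKoenigsInterior (hφ : IsSemigroup disk φ) (h0 : ∀ t, 0 ≤ t → φ t 0 = 0)
    {G P : ℂ → ℂ} (hG : IsGenerator disk φ G) (hP : IsKoenigsLog G P) :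
    ∃ h, IsKoenigsInterior φ 0 h := by
  have hn : ∀ t, 0 ≤ t → ‖deriv (φ t) 0‖ ≤ 1 := fun t ht => by
    have h1 := hφ.holomorphic t ht
    have h2 := hφ.mapsTo t ht
    rw [disk_eq_ball] at h1 h2
    exact Complex.norm_deriv_le_one_of_mapsTo_ball h1
      (by rw [h0 t ht]; exact h2.mono_right Metric.ball_subset_closedBall) one_pos
  have hnorm : ∀ t, 0 ≤ t → ‖deriv (φ t) 0‖ = Real.exp ((deriv G 0).re * t) := fun t ht => by
    rw [hφ.deriv_eq_exp h0 hG hP ht, Complex.norm_exp]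
    simp
  have hle : (deriv G 0).re ≤ 0 := by
    have := hn 1 zero_le_one
    rwa [hnorm 1 zero_le_one, mul_one, Real.exp_le_one_iff] at this
  rcases hle.lt_or_eq with hlt | heq
  · refine ⟨fun z => z * Complex.exp (P z), fun z hz =>
      (hP.hasDerivAt hz).differentiableAt.differentiableWithinAt, fun z hz w hw h =>
      hφ.eq_of_koenigsLog_eq h0 hG hP hlt hz hw h, by simp, fun t ht z hz => ?_⟩
    rw [hφ.koenigsLog_schroeder h0 hG hP ht hz, hφ.deriv_eq_exp h0 hG hP ht]
  -- Here `‖(φ t)'(0)‖ = 1`, so every `φ t` is a rotation.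
  · refine ⟨id, differentiableOn_id, injOn_id _, rfl, fun t ht z hz => ?_⟩
    exact eqOn_rotation (hφ.holomorphic t ht) (hφ.mapsTo t ht) (h0 t ht)
      (by rw [hnorm t ht, heq]; simp) hz

/-- Every Koenigs function is a multiple of `z ↦ z * exp (P z)`. -/
theorem koenigs_eq_const_mul (hφ : IsSemigroup disk φ) (h0 : ∀ t, 0 ≤ t → φ t 0 = 0)
    (hnt : IsNontrivial disk φ) {G P h : ℂ → ℂ} (hG : IsGenerator disk φ G)
    (hP : IsKoenigsLog G P) (hh : IsKoenigsInterior φ 0 h) :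
    ∃ c ≠ 0, ∀ z ∈ disk, h z = c * (z * Complex.exp (P z)) := by
  have hn := disk_mem_nhds zero_mem_disk
  have hode : ∀ z ∈ disk, deriv h z * G z = deriv G 0 * h z := fun z hz => by
    have h1 := (hh.holomorphic.differentiableAt (disk_mem_nhds hz)).hasDerivAt
    have hz0 := hφ.zero z hz
    have h2 := HasDerivAt.comp_hasDerivWithinAt (h₂ := h) (0 : ℝ) (by rw [hz0]; exact h1)
      (hG.hasDerivWithinAt hφ hz le_rfl)
    rw [hz0] at h2
    have h3 : HasDerivAt (fun t : ℝ => Complex.exp (deriv G 0 * t) * h z)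
        (deriv G 0 * h z) 0 := by
      have := ((((hasDerivAt_id (0 : ℝ)).ofReal_comp).const_mul (deriv G 0)).cexp).mul_const (h z)
      simpa using this
    refine (uniqueDiffOn_Ici (0 : ℝ) 0 self_mem_Ici).eq_deriv _ h2
      (h3.hasDerivWithinAt.congr_of_mem (fun t ht => ?_) self_mem_Ici)
    simp only [Function.comp_apply]
    rw [hh.schroeder t ht z hz, hφ.deriv_eq_exp h0 hG hP ht]
  -- `q` is the quotient of two solutions of the same linear equation, extended across `0`; hence it
  -- is constant.
  set q : ℂ → ℂ := fun z => dslope h 0 z * Complex.exp (-P z) with hq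
  have hds : DifferentiableOn ℂ (dslope h 0) disk :=
    (Complex.differentiableOn_dslope hn).2 hh.holomorphic
  have hqd : DifferentiableOn ℂ q disk := hds.mul hP.holomorphic.neg.cexp
  have hmul : ∀ z, z * dslope h 0 z = h z := generator_eq_mul_dslope hh.map_point
  have hzero : EqOn (deriv q) 0 (disk \ {0}) := fun z hz => by
    have hz0 : z ≠ 0 := hz.2
    have h1 := (hds.differentiableAt (disk_mem_nhds hz.1)).hasDerivAt
    have h2 := (hP.holomorphic.differentiableAt (disk_mem_nhds hz.1)).hasDerivAt
    have h3 : HasDerivAt h (dslope h 0 z + z * deriv (dslope h 0) z) z := by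
      have := ((hasDerivAt_id z).mul h1).congr_of_eventuallyEq (f₁ := h)
        (Eventually.of_forall fun w => (hmul w).symm)
      simpa using this
    have h4 := hode z hz.1
    rw [h3.deriv, ← hmul z, ← generator_eq_mul_dslope (hφ.generator_zero h0 hG) z,
      ← hP.deriv_eq z hz.1] at h4
    have hg := hφ.dslope_generator_ne_zero h0 hG hnt hz.1
    have h5 : deriv (dslope h 0) z = dslope h 0 z * deriv P z := by
      refine mul_left_cancel₀ (mul_ne_zero (mul_ne_zero hz0 hz0) hg) ?_
      linear_combination h4
    rw [(show HasDerivAt q _ z from h1.mul h2.neg.cexp).deriv, h5]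
    simp only [Pi.zero_apply, Pi.neg_apply]
    ring
  have hall : EqOn (deriv q) 0 disk := fun z hz => by
    rcases eq_or_ne z 0 with rfl | hz0
    · have hc : ContinuousAt (deriv q) 0 :=
        ((hqd.deriv isOpen_disk).differentiableAt hn).continuousAt
      refine tendsto_nhds_unique (hc.tendsto.mono_left (nhdsWithin_le_nhds (s := {0}ᶜ))) ?_
      refine tendsto_const_nhds.congr' ?_
      filter_upwards [nhdsWithin_le_nhds hn, self_mem_nhdsWithin] with w hw hw0
      exact (hzero ⟨hw, hw0⟩).symm
    · exact hzero ⟨hz, hz0⟩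
  obtain ⟨c, hc⟩ := isOpen_disk.exists_is_const_of_deriv_eq_zero isPreconnected_disk hqd hall
  have heq : ∀ z ∈ disk, h z = c * (z * Complex.exp (P z)) := fun z hz => by
    have h1 : dslope h 0 z = c * Complex.exp (P z) := by
      rw [← hc z hz, hq]
      simp only
      rw [mul_assoc, ← Complex.exp_add]
      simp
    rw [← hmul z, h1]
    ring
  refine ⟨c, ?_, heq⟩
  rintro rfl
  have hhalf : (1 / 2 : ℂ) ∈ disk := by norm_num [disk]
  have := hh.univalent zero_mem_disk hhalf (by rw [heq _ zero_mem_disk, heq _ hhalf]; simp)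
  norm_num at this

end IsSemigroup
-- The exponential and Cayley maps
theorem exp_neg_mem_disk {z : ℂ} (hz : z ∈ halfPlane) : Complex.exp (-z) ∈ disk := by
  have : 0 < z.re := hz
  change ‖_‖ < 1
  rw [Complex.norm_exp, Real.exp_lt_one_iff, Complex.neg_re]
  linarith

theorem cayley_mem_halfPlane {ζ : ℂ} (hζ : ζ ∈ disk) : cayley ζ ∈ halfPlane := by
  have h1 : ‖ζ‖ < 1 := hζ
  have hne : 1 - ζ ≠ 0 := fun h => by
    rw [← sub_eq_zero.1 h] at h1; simp at h1
  change 0 < (cayley ζ).re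
  rw [cayley, Complex.div_re, ← add_div]
  refine div_pos ?_ (Complex.normSq_pos.2 hne)
  have h2 : Complex.normSq ζ < 1 := by
    rw [Complex.normSq_eq_norm_sq]
    nlinarith [norm_nonneg ζ]
  rw [Complex.normSq_apply] at h2
  simp only [Complex.add_re, Complex.sub_re, Complex.one_re, Complex.add_im, Complex.sub_im,
    Complex.one_im]
  nlinarith

theorem cayley_cayleyInv {w : ℂ} (hw : w ∈ halfPlane) : cayley (cayleyInv w) = w := by
  have h : w + 1 ≠ 0 := fun h => by
    have h1 : 0 < w.re := hw
    have := congrArg Complex.re h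
    simp at this
    linarith
  have h2 : 1 - (w - 1) / (w + 1) ≠ 0 := by
    rw [one_sub_div h]
    refine div_ne_zero ?_ h
    ring_nf
    exact two_ne_zero
  rw [cayley, cayleyInv, div_eq_iff h2]
  field_simp
  ring

theorem cayleyInv_mem_disk {w : ℂ} (hw : w ∈ halfPlane) : cayleyInv w ∈ disk := by
  have h1 : 0 < w.re := hw
  have h : w + 1 ≠ 0 := fun h => by
    have := congrArg Complex.re h
    simp at this
    linarith
  change ‖cayleyInv w‖ < 1
  rw [cayleyInv, norm_div, div_lt_one (norm_pos_iff.2 h)]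
  refine lt_of_pow_lt_pow_left₀ 2 (norm_nonneg _) ?_
  rw [← Complex.normSq_eq_norm_sq, ← Complex.normSq_eq_norm_sq, Complex.normSq_apply,
    Complex.normSq_apply]
  simp only [Complex.add_re, Complex.sub_re, Complex.one_re, Complex.add_im, Complex.sub_im,
    Complex.one_im]
  nlinarith

/-- In a Stolz region at `1`, the real part of the Cayley map tends to infinity. -/
theorem tendsto_re_cayley (M : ℝ) :
    Tendsto (fun ζ => (cayley ζ).re) (𝓝[stolz 1 M] 1) atTop := by
  rcases le_or_gt M 0 with hM | hM
  · have : stolz 1 M = ∅ := by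
      ext ζ
      simp only [stolz, mem_ofPred_eq, mem_empty_iff_false, iff_false, not_and, not_lt]
      intro h
      have := mul_nonneg_of_nonpos_of_nonpos hM (by linarith : ‖ζ‖ - 1 ≤ 0)
      linarith [norm_nonneg (ζ - 1)]
    rw [this, nhdsWithin_empty]
    exact tendsto_bot
  have hne : ∀ ζ ∈ stolz 1 M, 0 < ‖ζ - 1‖ := fun ζ hζ => by
    refine norm_pos_iff.2 fun h => ?_
    have := hζ.1
    rw [sub_eq_zero.1 h] at this
    simp at this
  have hlim : Tendsto (fun ζ : ℂ => M * ‖ζ - 1‖) (𝓝[stolz 1 M] 1) (𝓝[>] 0) := by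
    refine tendsto_nhdsWithin_iff.2 ⟨?_, ?_⟩
    · have : Continuous fun ζ : ℂ => M * ‖ζ - 1‖ := by fun_prop
      simpa using (this.tendsto 1).mono_left nhdsWithin_le_nhds
    · filter_upwards [self_mem_nhdsWithin] with ζ hζ
      exact mul_pos hM (hne ζ hζ)
  refine tendsto_atTop_mono' _ ?_ (tendsto_inv_nhdsGT_zero.comp hlim)
  filter_upwards [self_mem_nhdsWithin] with ζ hζ
  have hd := hne ζ hζ
  have h1 : ‖ζ‖ < 1 := hζ.1
  have h2 : ‖ζ - 1‖ < M * (1 - ‖ζ‖) := hζ.2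
  -- In the Stolz region this is at least `1 / (M ‖ζ - 1‖)`.
  have hre : (cayley ζ).re = (1 - ‖ζ‖ ^ 2) / ‖ζ - 1‖ ^ 2 := by
    rw [norm_sub_rev, ← Complex.normSq_eq_norm_sq, ← Complex.normSq_eq_norm_sq, cayley,
      Complex.div_re, ← add_div, Complex.normSq_apply ζ]
    simp only [Complex.add_re, Complex.sub_re, Complex.one_re, Complex.add_im, Complex.sub_im,
      Complex.one_im]
    ring
  rw [hre, Function.comp_apply, inv_eq_one_div, div_le_div_iff₀ (by positivity) (by positivity)]
  have h3 : 0 ≤ ‖ζ‖ := norm_nonneg ζ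
  have h4 : ‖ζ - 1‖ ≤ M * (1 - ‖ζ‖ ^ 2) := by nlinarith
  nlinarith

/-! ### Uniqueness of lifts and of Abel solutions -/

/-- Two holomorphic liftings of the same function differ by a constant. -/
theorem exists_eq_add_of_exp_eq {A B : ℂ → ℂ} (hA : DifferentiableOn ℂ A halfPlane)
    (hB : DifferentiableOn ℂ B halfPlane)
    (h : ∀ z ∈ halfPlane, Complex.exp (-A z) = Complex.exp (-B z)) :
    ∃ c, ∀ z ∈ halfPlane, A z = B z + c := by
  refine isOpen_halfPlane.exists_eq_add_of_deriv_eq isPreconnected_halfPlane hA hB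
    fun z hz => ?_
  have hn := isOpen_halfPlane.mem_nhds hz
  have h1 := (hA.differentiableAt hn).hasDerivAt.neg.cexp
  have h2 := (hB.differentiableAt hn).hasDerivAt.neg.cexp
  have h3 := h1.unique (h2.congr_of_eventuallyEq (by
    filter_upwards [hn] with w hw
    exact h w hw))
  simp only [Pi.neg_apply, h z hz] at h3
  exact neg_injective (mul_left_cancel₀ (Complex.exp_ne_zero _) h3)

/-- The map at time `t` is an iterate of the map at time `t / (n + 1)`, which is small for large
`n`. -/
theorem eqOn_of_eqOn_small {D : Set ℂ} {φ ψ : ℝ → ℂ → ℂ} (hφ : IsSemigroup D φ)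
    (hψ : IsSemigroup D ψ) (h : ∀ᶠ t in 𝓝[>] (0 : ℝ), EqOn (φ t) (ψ t) D) {t : ℝ} (ht : 0 ≤ t) :
    EqOn (φ t) (ψ t) D := by
  have hmul : ∀ s, 0 ≤ s → EqOn (φ s) (ψ s) D → ∀ n : ℕ, EqOn (φ (n * s)) (ψ (n * s)) D := by
    intro s hs hsD n z hz
    induction n with
    | zero => simp [hφ.zero z hz, hψ.zero z hz]
    | succ n ih =>
      have hns : 0 ≤ (n : ℝ) * s := by positivity
      have : ((n + 1 : ℕ) : ℝ) * s = s + n * s := by push_cast; ring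
      rw [this, hφ.add s _ hs hns z hz, hψ.add s _ hs hns z hz, ih]
      exact hsD (hψ.mapsTo _ hns hz)
  rcases ht.eq_or_lt with rfl | ht0
  · intro z hz
    rw [hφ.zero z hz, hψ.zero z hz]
  have hlim : Tendsto (fun n : ℕ => t / (n + 1 : ℕ)) atTop (𝓝[>] 0) := by
    refine tendsto_nhdsWithin_iff.2 ⟨?_, Eventually.of_forall fun n => ?_⟩
    · exact (tendsto_const_div_atTop_nhds_zero_nat t).comp (tendsto_add_atTop_nat 1)
    · exact mem_Ioi.2 (by positivity)
  obtain ⟨n, hn⟩ := (hlim.eventually h).exists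
  have h1 := hmul _ (by positivity) hn (n + 1)
  have h2 : ((n + 1 : ℕ) : ℝ) * (t / (n + 1 : ℕ)) = t := by
    have : ((n + 1 : ℕ) : ℝ) ≠ 0 := by positivity
    field_simp
  rwa [h2] at h1

/-- A lifting of a semigroup in the disk to a semigroup in the half-plane is unique. -/
theorem Lifts.unique {φ ψ ψ' : ℝ → ℂ → ℂ} (hψ : IsSemigroup halfPlane ψ)
    (hψ' : IsSemigroup halfPlane ψ') (h : Lifts φ ψ) (h' : Lifts φ ψ') {t : ℝ} (ht : 0 ≤ t) :
    EqOn (ψ' t) (ψ t) halfPlane := by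
  refine eqOn_of_eqOn_small hψ' hψ ?_ ht
  have hone : (1 : ℂ) ∈ halfPlane := by simp [halfPlane]
  have hev : ∀ᶠ t in 𝓝[>] (0 : ℝ), (0 : ℝ) ≤ t := by
    filter_upwards [self_mem_nhdsWithin] with t ht
    exact (mem_Ioi.1 ht).le
  -- At fixed `t` the lifts differ by a constant. At the point `1` both tend to `1` as `t → 0`, so
  -- local injectivity of `exp` makes the constant `0` for small `t`.
  have h1 := eventuallyEq_of_hasStrictDerivAt (Complex.hasStrictDerivAt_exp (-1))
    (Complex.exp_ne_zero _) (hψ'.tendsto_zero 1 hone).neg (hψ.tendsto_zero 1 hone).neg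
    (hev.mono fun t ht => by rw [h t ht 1 hone, h' t ht 1 hone])
  filter_upwards [h1, hev] with t h1 ht z hz
  obtain ⟨c, hc⟩ := exists_eq_add_of_exp_eq (hψ'.holomorphic t ht) (hψ.holomorphic t ht)
    fun z hz => by rw [h t ht z hz, h' t ht z hz]
  have h2 := hc 1 hone
  rw [neg_injective h1, left_eq_add] at h2
  rw [hc z hz, h2, add_zero]

/-- The derivative of a Koenigs function is the reciprocal of the generator. -/
theorem IsKoenigsBoundary.deriv_mul_generator {ψ : ℝ → ℂ → ℂ} {k G : ℂ → ℂ}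
    (hk : IsKoenigsBoundary ψ k) (hψ : IsSemigroup halfPlane ψ)
    (hG : IsGenerator halfPlane ψ G) {z : ℂ} (hz : z ∈ halfPlane) : deriv k z * G z = 1 := by
  have h1 := (hk.holomorphic.differentiableAt (isOpen_halfPlane.mem_nhds hz)).hasDerivAt
  have hz0 := hψ.zero z hz
  have h2 := HasDerivAt.comp_hasDerivWithinAt (h₂ := k) (0 : ℝ) (by rw [hz0]; exact h1)
    (hG.hasDerivWithinAt hψ hz le_rfl)
  rw [hz0] at h2
  have h3 : HasDerivAt (fun t : ℝ => k z + t) 1 0 :=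
    ((hasDerivAt_id (0 : ℝ)).ofReal_comp).const_add (k z)
  exact (uniqueDiffOn_Ici (0 : ℝ) 0 self_mem_Ici).eq_deriv _ h2
    (h3.hasDerivWithinAt.congr_of_mem (fun t ht => hk.abel t ht z hz) self_mem_Ici)

theorem IsKoenigsBoundary.exists_eq_add {ψ : ℝ → ℂ → ℂ} {k k' G : ℂ → ℂ}
    (hk : IsKoenigsBoundary ψ k) (hk' : IsKoenigsBoundary ψ k') (hψ : IsSemigroup halfPlane ψ)
    (hG : IsGenerator halfPlane ψ G) : ∃ c, ∀ z ∈ halfPlane, k z = k' z + c := by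
  refine isOpen_halfPlane.exists_eq_add_of_deriv_eq isPreconnected_halfPlane hk.holomorphic
    hk'.holomorphic fun z hz => ?_
  have h1 := hk.deriv_mul_generator hψ hG hz
  have h2 := hk'.deriv_mul_generator hψ hG hz
  exact mul_right_cancel₀ (right_ne_zero_of_mul_eq_one h1) (h1.trans h2.symm)

/-! ### The explicit lift and its Koenigs functions -/

/-- The lifting to the half-plane of the semigroup `φ`, where `lam` is the derivative of the
generator at the origin and `z ↦ z * exp (P z)` solves the Schröder equation. -/
noncomputable def lift (φ : ℝ → ℂ → ℂ) (lam : ℂ) (P : ℂ → ℂ) (t : ℝ) (z : ℂ) : ℂ :=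
  z - lam * t - P (Complex.exp (-z)) + P (φ t (Complex.exp (-z)))

namespace IsSemigroup

variable {φ : ℝ → ℂ → ℂ} {G P : ℂ → ℂ}

theorem lifts_lift (hφ : IsSemigroup disk φ) (h0 : ∀ t, 0 ≤ t → φ t 0 = 0)
    (hG : IsGenerator disk φ G) (hP : IsKoenigsLog G P) : Lifts φ (lift φ (deriv G 0) P) := by
  intro t ht z hz
  have h1 := hφ.koenigsLog_schroeder h0 hG hP ht (exp_neg_mem_disk hz)
  refine mul_right_cancel₀ (Complex.exp_ne_zero (P (φ t (Complex.exp (-z))))) ?_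
  rw [h1, lift, ← Complex.exp_add, ← Complex.exp_add, ← Complex.exp_add]
  ring_nf

theorem isSemigroup_lift (hφ : IsSemigroup disk φ) (h0 : ∀ t, 0 ≤ t → φ t 0 = 0)
    (hG : IsGenerator disk φ G) (hP : IsKoenigsLog G P) :
    IsSemigroup halfPlane (lift φ (deriv G 0) P) := by
  have hmap : ∀ t, 0 ≤ t → MapsTo (lift φ (deriv G 0) P t) halfPlane halfPlane :=
    fun t ht z hz => by
      have h1 : ‖φ t (Complex.exp (-z))‖ < 1 := hφ.mapsTo t ht (exp_neg_mem_disk hz)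
      rw [← hφ.lifts_lift h0 hG hP t ht z hz, Complex.norm_exp, Real.exp_lt_one_iff,
        Complex.neg_re, neg_lt_zero] at h1
      exact h1
  have hexp : DifferentiableOn ℂ (fun z => Complex.exp (-z)) halfPlane := by fun_prop
  have hexpm : MapsTo (fun z => Complex.exp (-z)) halfPlane disk := fun z hz =>
    exp_neg_mem_disk hz
  refine ⟨hmap, fun t ht => ?_, fun z hz => ?_, fun s t hs ht z hz => ?_, fun z hz => ?_⟩
  · refine DifferentiableOn.add ((differentiableOn_id.sub_const _).sub
      (hP.holomorphic.comp hexp hexpm)) ?_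
    exact hP.holomorphic.comp ((hφ.holomorphic t ht).comp hexp hexpm)
      ((hφ.mapsTo t ht).comp hexpm)
  · simp [lift, hφ.zero _ (exp_neg_mem_disk hz)]
  -- The `P` terms telescope, since `exp (-ψ_t z) = φ_t (exp (-z))`.
  · rw [lift.eq_1 φ _ P s, hφ.lifts_lift h0 hG hP t ht z hz,
      ← hφ.add s t hs ht _ (exp_neg_mem_disk hz), lift, lift]
    push_cast
    ring
  · have hw := exp_neg_mem_disk hz
    have h1 : Tendsto (fun t => P (φ t (Complex.exp (-z)))) (𝓝[>] 0) (𝓝 (P (Complex.exp (-z)))) :=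
      (hP.holomorphic.differentiableAt (disk_mem_nhds hw)).continuousAt.tendsto.comp
        (hφ.tendsto_zero _ hw)
    have h2 : Tendsto (fun t : ℝ => z - deriv G 0 * t - P (Complex.exp (-z))) (𝓝[>] 0)
        (𝓝 (z - P (Complex.exp (-z)))) := by
      have : Continuous fun t : ℝ => z - deriv G 0 * t - P (Complex.exp (-z)) := by fun_prop
      simpa using (this.tendsto 0).mono_left nhdsWithin_le_nhds
    simpa [lift] using h2.add h1

theorem isGenerator_lift (hφ : IsSemigroup disk φ) (h0 : ∀ t, 0 ≤ t → φ t 0 = 0)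
    (hG : IsGenerator disk φ G) (hP : IsKoenigsLog G P) :
    IsGenerator halfPlane (lift φ (deriv G 0) P)
      (fun z => -(G (Complex.exp (-z)) / Complex.exp (-z))) := by
  intro z hz
  have hw := exp_neg_mem_disk hz
  have hwne := Complex.exp_ne_zero (-z)
  set w := Complex.exp (-z) with hwdef
  have hPd := (hP.holomorphic.differentiableAt (disk_mem_nhds hw)).hasDerivAt
  have hz0 := hφ.zero w hw
  have h1 := HasDerivAt.comp_hasDerivWithinAt (h₂ := P) (0 : ℝ) (by rw [hz0]; exact hPd)
    (hG.hasDerivWithinAt hφ hw le_rfl)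
  rw [hz0] at h1
  have h2 : HasDerivAt (fun t : ℝ => z - deriv G 0 * t - P w) (-deriv G 0) 0 := by
    have := ((((hasDerivAt_id (0 : ℝ)).ofReal_comp).const_mul (deriv G 0)).const_sub z).sub_const
      (P w)
    simpa using this
  have h3 : HasDerivWithinAt (fun t => lift φ (deriv G 0) P t z)
      (-deriv G 0 + deriv P w * G w) (Ici 0) 0 := h2.hasDerivWithinAt.add h1
  have h4 : -deriv G 0 + deriv P w * G w = -(G w / w) := by
    rw [← generator_eq_mul_dslope (hφ.generator_zero h0 hG) w, ← hP.deriv_eq w hw]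
    field_simp
    ring
  rw [h4, ← hasDerivWithinAt_Ioi_iff_Ici, hasDerivWithinAt_iff_tendsto_slope' (by simp)] at h3
  refine h3.congr fun t => ?_
  rw [slope_def_module, (hφ.isSemigroup_lift h0 hG hP).zero z hz, sub_zero, Complex.real_smul,
    Complex.ofReal_inv, ← div_eq_inv_mul]

theorem isMapDWPoint_lift (hφ : IsSemigroup disk φ) (h0 : ∀ t, 0 ≤ t → φ t 0 = 0)
    (hP : IsKoenigsLog G P) (lam : ℂ) {t : ℝ} (ht : 0 ≤ t)
    (hm : MapsTo (lift φ lam P t) halfPlane halfPlane) :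
    IsMapDWPoint (fun ζ => cayleyInv (lift φ lam P t (cayley ζ))) 1 := by
  have hn := disk_mem_nhds zero_mem_disk
  have hdiff : ∀ M, Tendsto (fun ζ => lift φ lam P t (cayley ζ) - cayley ζ) (𝓝[stolz 1 M] 1)
      (𝓝 (-(lam * t))) := fun M => by
    have hexp : Tendsto (fun ζ => Complex.exp (-cayley ζ)) (𝓝[stolz 1 M] 1) (𝓝 0) := by
      rw [tendsto_zero_iff_norm_tendsto_zero]
      simp_rw [Complex.norm_exp, Complex.neg_re]
      exact Real.tendsto_exp_neg_atTop_nhds_zero.comp (tendsto_re_cayley M)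
    have hPc := (hP.holomorphic.differentiableAt hn).continuousAt.tendsto
    rw [hP.map_zero] at hPc
    have hφc := ((hφ.holomorphic t ht).differentiableAt hn).continuousAt.tendsto
    rw [h0 t ht] at hφc
    have := ((hPc.comp (hφc.comp hexp)).sub (hPc.comp hexp)).add_const (-(lam * t))
    rw [sub_zero, zero_add] at this
    refine this.congr fun ζ => ?_
    simp only [Function.comp_apply, lift]
    ring
  have hquot : ∀ M, Tendsto (fun ζ => (cayleyInv (lift φ lam P t (cayley ζ)) - 1) / (ζ - 1))
      (𝓝[stolz 1 M] 1) (𝓝 1) := fun M => by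
    have hid : Tendsto (fun ζ : ℂ => (1 - ζ) / 2) (𝓝[stolz 1 M] 1) (𝓝 0) := by
      have : Continuous fun ζ : ℂ => (1 - ζ) / 2 := by fun_prop
      simpa using (this.tendsto 1).mono_left nhdsWithin_le_nhds
    have h1 := (((hdiff M).mul hid).const_add 1).inv₀ (by simp)
    rw [mul_zero, add_zero, inv_one] at h1
    refine h1.congr' ?_
    filter_upwards [self_mem_nhdsWithin] with ζ hζ
    have hζd : ζ ∈ disk := hζ.1
    have hζ1 : 1 - ζ ≠ 0 := fun h => by
      have : ‖ζ‖ < 1 := hζd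
      rw [← sub_eq_zero.1 h] at this; simp at this
    have hζ2 : ζ - 1 ≠ 0 := by rw [← neg_sub]; exact neg_ne_zero.2 hζ1
    set v := lift φ lam P t (cayley ζ) with hv
    have hvp : 0 < v.re := hm (cayley_mem_halfPlane hζd)
    have hv1 : v + 1 ≠ 0 := fun h => by
      have := congrArg Complex.re h
      simp at this
      linarith
    -- As `cayley ζ + 1 = 2 / (1 - ζ)`, the quotient is the inverse of this expression. The
    -- difference `v - cayley ζ` stays bounded near `1`, so the angular derivative is `1`.
    have h2 : 1 + (v - cayley ζ) * ((1 - ζ) / 2) = (v + 1) * ((1 - ζ) / 2) := by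
      rw [cayley]
      field_simp
      ring
    rw [h2, cayleyInv, div_sub_one hv1]
    field_simp
    ring
  refine Or.inr ⟨norm_one, fun M => ?_, 1, hquot, norm_one.le⟩
  have hid : Tendsto (fun ζ : ℂ => ζ - 1) (𝓝[stolz 1 M] 1) (𝓝 0) := by
    have : Continuous fun ζ : ℂ => ζ - 1 := by fun_prop
    simpa using (this.tendsto 1).mono_left nhdsWithin_le_nhds
  have h1 := ((hquot M).mul hid).add_const 1
  rw [mul_zero, zero_add] at h1
  refine h1.congr' ?_
  filter_upwards [self_mem_nhdsWithin] with ζ hζ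
  have hζ2 : ζ - 1 ≠ 0 := fun h => by
    have : ‖ζ‖ < 1 := hζ.1
    rw [sub_eq_zero.1 h] at this; simp at this
  rw [div_mul_cancel₀ _ hζ2, sub_add_cancel]

theorem hasDWPointInfty_lift (hφ : IsSemigroup disk φ) (h0 : ∀ t, 0 ≤ t → φ t 0 = 0)
    (hnt : IsNontrivial disk φ) (hG : IsGenerator disk φ G) (hP : IsKoenigsLog G P) :
    HasDWPointInfty (lift φ (deriv G 0) P) := by
  have hsg := hφ.isSemigroup_lift h0 hG hP
  refine ⟨?_, fun t ht _ => hφ.isMapDWPoint_lift h0 hP _ ht.le (hsg.mapsTo t ht.le)⟩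
  obtain ⟨t, ht, z, hz, hne⟩ := hnt
  have hz0 : z ≠ 0 := by
    rintro rfl
    exact hne (h0 t ht)
  have hlog : -Complex.log z ∈ halfPlane := by
    change 0 < (-Complex.log z).re
    rw [Complex.neg_re, Complex.log_re, neg_pos]
    exact Real.log_neg (norm_pos_iff.2 hz0) hz
  -- A preimage of a moved point is moved by the lift, as exponentiating shows.
  refine ⟨t, ht, cayleyInv (-Complex.log z), cayleyInv_mem_disk hlog, fun h => hne ?_⟩
  simp only [cayley_cayleyInv hlog] at h
  have h1 := congrArg cayley h
  rw [cayley_cayleyInv hlog, cayley_cayleyInv (hsg.mapsTo t ht hlog)] at h1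
  have h2 := hφ.lifts_lift h0 hG hP t ht _ hlog
  rw [h1, neg_neg, Complex.exp_log hz0] at h2
  exact h2.symm

theorem exists_isExpLifting (hφ : IsSemigroup disk φ) (h0 : ∀ t, 0 ≤ t → φ t 0 = 0)
    (hnt : IsNontrivial disk φ) (hG : IsGenerator disk φ G) (hP : IsKoenigsLog G P) {h : ℂ → ℂ}
    (hh : IsKoenigsInterior φ 0 h) :
    ∃ c, IsExpLifting h (fun z => z - P (Complex.exp (-z)) + c) := by
  obtain ⟨c, hc, heq⟩ := hφ.koenigs_eq_const_mul h0 hnt hG hP hh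
  refine ⟨-Complex.log c, ?_, fun z hz => ?_⟩
  · refine DifferentiableOn.add_const _ (differentiableOn_id.sub
      (hP.holomorphic.comp (t := disk) ?_ fun z hz => exp_neg_mem_disk hz))
    fun_prop
  · rw [heq _ (exp_neg_mem_disk hz)]
    have h1 : -(z - P (Complex.exp (-z)) + -Complex.log c) =
        Complex.log c + (-z + P (Complex.exp (-z))) := by ring
    simp only
    rw [h1, Complex.exp_add, Complex.exp_add, Complex.exp_log hc]

/-- `H` is `z - P (exp (-z))` up to a constant. If `H z = H w`, univalence of `h` gives `exp (-z) =
exp (-w)`, so the `P` terms cancel and `z = w`. -/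
theorem isKoenigsBoundary_of_isExpLifting (hφ : IsSemigroup disk φ)
    (h0 : ∀ t, 0 ≤ t → φ t 0 = 0) (hnt : IsNontrivial disk φ) (hG : IsGenerator disk φ G)
    (hP : IsKoenigsLog G P) {h H : ℂ → ℂ} (hh : IsKoenigsInterior φ 0 h)
    (hH : IsExpLifting h H) :
    IsKoenigsBoundary (lift φ (deriv G 0) P) (fun z => -(H z / deriv G 0)) := by
  have hlam := hφ.deriv_generator_ne_zero h0 hG hnt
  obtain ⟨c, hc⟩ := hφ.exists_isExpLifting h0 hnt hG hP hh
  obtain ⟨d, hd⟩ := exists_eq_add_of_exp_eq hH.1 hc.1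
    fun z hz => by rw [hH.2 z hz, hc.2 z hz]
  refine ⟨(hH.1.div_const _).neg, fun z hz w hw hzw => ?_, fun t ht z hz => ?_⟩
  · have h1 : H z = H w := by
      have := neg_injective hzw
      rwa [div_left_inj' hlam] at this
    have h2 : Complex.exp (-z) = Complex.exp (-w) :=
      hh.univalent (exp_neg_mem_disk hz) (exp_neg_mem_disk hw)
        (by rw [← hH.2 z hz, ← hH.2 w hw, h1])
    rw [hd z hz, hd w hw, h2] at h1
    linear_combination h1
  · rw [hd z hz, hd _ ((hφ.isSemigroup_lift h0 hG hP).mapsTo t ht hz),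
      hφ.lifts_lift h0 hG hP t ht z hz, lift]
    field_simp
    ring

end IsSemigroup
end SemigroupLift

theorem proposition2p1 (φ : ℝ → ℂ → ℂ)
    (hφ : SemigroupLift.IsSemigroup SemigroupLift.disk φ)
    (hnt : SemigroupLift.IsNontrivial SemigroupLift.disk φ)
    (hDW : SemigroupLift.IsDWPoint φ 0) :
    (∃ G : ℂ → ℂ, SemigroupLift.IsGenerator SemigroupLift.disk φ G) ∧
    (∃ h : ℂ → ℂ, SemigroupLift.IsKoenigsInterior φ 0 h) ∧
    ∃ ψ : ℝ → ℂ → ℂ,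
      (SemigroupLift.IsSemigroup SemigroupLift.halfPlane ψ ∧
        SemigroupLift.HasDWPointInfty ψ ∧ SemigroupLift.Lifts φ ψ) ∧
      (∀ ψ' : ℝ → ℂ → ℂ, SemigroupLift.IsSemigroup SemigroupLift.halfPlane ψ' →
        SemigroupLift.HasDWPointInfty ψ' → SemigroupLift.Lifts φ ψ' →
        ∀ t, 0 ≤ t → Set.EqOn (ψ' t) (ψ t) SemigroupLift.halfPlane) ∧
      ∀ G : ℂ → ℂ, SemigroupLift.IsGenerator SemigroupLift.disk φ G →
        SemigroupLift.IsGenerator SemigroupLift.halfPlane ψ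
          (fun z => -(G (Complex.exp (-z)) / Complex.exp (-z))) ∧
        deriv G 0 ≠ 0 ∧
        ∀ h : ℂ → ℂ, SemigroupLift.IsKoenigsInterior φ 0 h →
          (∃ H : ℂ → ℂ, SemigroupLift.IsExpLifting h H) ∧
          ∀ H : ℂ → ℂ, SemigroupLift.IsExpLifting h H →
            SemigroupLift.IsKoenigsBoundary ψ (fun z => -(H z / deriv G 0)) ∧
            ∀ k : ℂ → ℂ, SemigroupLift.IsKoenigsBoundary ψ k →
              ∃ c : ℂ, ∀ z ∈ SemigroupLift.halfPlane, k z = -(H z / deriv G 0) + c := by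
  have h0 : ∀ t, 0 ≤ t → φ t 0 = 0 := fun t ht => by
    -- The DW-point says nothing about times at which the map is the identity, but those fix `0`
    -- trivially.
    by_cases hid : ∃ z ∈ SemigroupLift.disk, φ t z ≠ z
    · have ht0 : 0 < t := ht.lt_of_ne fun h => by
        obtain ⟨z, hz, hne⟩ := hid
        rw [← h] at hne
        exact hne (hφ.zero z hz)
      rcases hDW.2 t ht0 hid with ⟨_, h, _⟩ | ⟨h, _⟩
      · exact h
      · simp at h
    · push Not at hid
      exact hid 0 SemigroupLift.zero_mem_disk
  obtain ⟨G₀, hG₀⟩ := hφ.exists_isGenerator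
  obtain ⟨P, hP⟩ := SemigroupLift.exists_isKoenigsLog (hφ.differentiableOn_generator hG₀)
    fun z hz => hφ.dslope_generator_ne_zero h0 hG₀ hnt hz
  have hsg := hφ.isSemigroup_lift h0 hG₀ hP
  refine ⟨⟨G₀, hG₀⟩, hφ.exists_isKoenigsInterior h0 hG₀ hP,
    SemigroupLift.lift φ (deriv G₀ 0) P, ⟨hsg, hφ.hasDWPointInfty_lift h0 hnt hG₀ hP,
      hφ.lifts_lift h0 hG₀ hP⟩, fun ψ' hψ' _ hl t ht =>
      SemigroupLift.Lifts.unique hsg hψ' (hφ.lifts_lift h0 hG₀ hP) hl ht, fun G hG => ?_⟩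
  have hGG := hG.eqOn hG₀
  have hd : deriv G 0 = deriv G₀ 0 := Filter.EventuallyEq.deriv_eq (by
    filter_upwards [SemigroupLift.disk_mem_nhds SemigroupLift.zero_mem_disk] with z hz
    exact hGG hz)
  have hgen := hφ.isGenerator_lift h0 hG₀ hP
  rw [hd]
  refine ⟨fun z hz => ?_, hφ.deriv_generator_ne_zero h0 hG₀ hnt, fun h hh => ⟨?_, fun H hH => ?_⟩⟩
  · simp only [hGG (SemigroupLift.exp_neg_mem_disk hz)]
    exact hgen z hz
  · obtain ⟨c, hc⟩ := hφ.exists_isExpLifting h0 hnt hG₀ hP hh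
    exact ⟨_, hc⟩
  · have hk := hφ.isKoenigsBoundary_of_isExpLifting h0 hnt hG₀ hP hh hH
    exact ⟨hk, fun k hk' => hk'.exists_eq_add hk hsg hgen⟩
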